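/- Let $E$ be a finite non-empty set. For probability measures $\nu_1,\nu_2$ on $E$ put $d_{TV}(\nu_1,\nu_2)=\frac12\sum_{e\in E}|\nu_1(e)-\nu_2(e)|$. Let $q$ and $\bar q$ be probability kernels from $E^{\mathbb N}$ (with the product $\sigma$-field) to $E$ with $q(e\mid y)>0$ and $\bar q(e\mid y)>0$ for all $e\in E$, $y\in E^{\mathbb N}$. For $m\ge 0$ let $$b_m=\sup\{d_{TV}(q(\cdot\mid y),q(\cdot\mid y')) : y,y'\in E^{\mathbb N},\ y_i=y'_i \text{ for } 0\le i\le m-1\},$$ and define $\bar b_m$ in the same way from $\bar q$. Assume that $b_0<1$, $\bar b_0<1$, $b_m\to0$, $\bar b_m\to 0$ and $\sum_{m\ge1}(b_m+\bar b_m)<\infty$. Let $b_0^*=b_0$ and, for $n\ge1$, $b_n^*=\mathbb P(S_n=0)$, where $(S_n)_{n\ge0}$ is the Markov chain on $\mathbb N$ with $S_0=0$ and transition probabilities $P(i,i+1)=1-b_i$, $P(i,0)=b_i$. A stationary chain with transition kernel $q$ is a stationary $E$-valued process $(Y_t)_{t\in\mathbb Z}$ such that, for all $t\in\mathbb Z$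 and $e\in E$, $\mathbb P(Y_t=e\mid Y_{t-1},Y_{t-2},\ldots)=q(e\mid Y_{t-1},Y_{t-2},\ldots)$ almost surely. Then stationary chains with transition kernels $q$ and $\bar q$ exist and each is unique in law; moreover $\sum_{m\ge0}b_m^*<\infty$, and the laws $\pi$ of $Y_0$ and $\bar\pi$ of $\bar Y_0$, where $(Y_t)$ and $(\bar Y_t)$ are stationary chains with transition kernels $q$ and $\bar q$, satisfy $$d_{TV}(\pi,\bar\pi)\le\Bigl(1+\sum_{m\ge0}b_m^*\Bigr)\sup_{y\in E^{\mathbb N}}d_{TV}(q(\cdot\mid y),\bar q(\cdot\mid y)).$$ In the Markov case, where $q(\cdot\mid y)$ depends on $y_0$ only, one has $b_m=0$ and $b_m^*=b_0^m$ for $m\ge1$, $1+\sum_{m\ge1}b_m^*=(1-b_0)^{-1}$, and the classical bound in terms of the ergodicity coefficient $b_0$ holds: $$d_{TV}(\pi,\bar\pi)\le(1-b_0)^{-1}\sup_{y\in E^{\mathbb N}}d_{TV}(q(\cdot\mid y),\bar q(\cdot\mid y)).$$ -/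

import Mathlib

open MeasureTheory ProbabilityTheory Filter Topology

noncomputable section

namespace CompleteConnections

/-- Total variation distance between two (probability) measures on a finite set. -/
def dTV {E : Type*} [Fintype E] [MeasurableSpace E] (ν₁ ν₂ : Measure E) : ℝ :=
  (1 / 2) * ∑ e : E, |ν₁.real {e} - ν₂.real {e}|

/-- The continuity coefficient `b_m` of a kernel `q` from `E^ℕ` to `E`: the supremum of
`dTV (q y) (q y')` over the pairs of pasts with the same `m` most recent coordinates
(`y 0` is the most recent one). -/
def contCoeff {E : Type*} [Fintype E] [MeasurableSpace E]
    (q : Kernel (ℕ → E) E) (m : ℕ) : ℝ :=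
  sSup {r : ℝ | ∃ y y' : ℕ → E, (∀ i < m, y i = y' i) ∧ r = dTV (q y) (q y')}

/-- Positivity of the transition probabilities (measurability is part of `Kernel`). -/
def PositiveKernel {E : Type*} [MeasurableSpace E] (q : Kernel (ℕ → E) E) : Prop :=
  ∀ (y : ℕ → E) (e : E), 0 < (q y).real {e}

/-- `b_0 < 1` and `b_m → 0`. -/
def ContinuousKernel {E : Type*} [Fintype E] [MeasurableSpace E]
    (q : Kernel (ℕ → E) E) : Prop :=
  contCoeff q 0 < 1 ∧ Tendsto (contCoeff q) atTop (𝓝 0)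

/-- The transition matrix on `ℕ` with `P(i, i+1) = 1 - b_i` and `P(i, 0) = b_i`. -/
def houseMatrix (b : ℕ → ℝ) (i j : ℕ) : ℝ :=
  if j = i + 1 then 1 - b i else if j = 0 then b i else 0

/-- `houseLaw b n j = P(S_n = j)` for the Markov chain `(S_n)` on `ℕ` with `S_0 = 0` and
transition matrix `houseMatrix b`. The sums have only finitely many nonzero terms, as
`S_n ≤ n`. -/
def houseLaw (b : ℕ → ℝ) : ℕ → ℕ → ℝ
  | 0, j => if j = 0 then 1 else 0
  | n + 1, j => ∑' i : ℕ, houseLaw b n i * houseMatrix b i j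

/-- `b*_0 = b_0` and `b*_n = P(S_n = 0)` for `n ≥ 1`. -/
def bStar (b : ℕ → ℝ) (n : ℕ) : ℝ :=
  if n = 0 then b 0 else houseLaw b n 0

/-- The past `Y_{t-1}^- = (Y_{t-1}, Y_{t-2}, …)`. -/
def past {Ω E : Type*} (Y : ℤ → Ω → E) (t : ℤ) (ω : Ω) : ℕ → E :=
  fun j => Y (t - 1 - (j : ℤ)) ω

/-- `(Y_t)_{t ∈ ℤ}`, defined on the probability space `(Ω, P)`, is a stationary chain with
complete connections and transition kernel `q`: the law of the process is invariant under time
shifts and `P(Y_t = e | Y_{t-1}, Y_{t-2}, …) = q(e | Y_{t-1}, Y_{t-2}, …)` almost surely. -/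
structure IsStationaryChain {Ω E : Type*} [MeasurableSpace Ω] [MeasurableSpace E]
    (q : Kernel (ℕ → E) E) (P : Measure Ω) (Y : ℤ → Ω → E) : Prop where
  isProbabilityMeasure : IsProbabilityMeasure P
  measurable : ∀ t, Measurable (Y t)
  stationary : ∀ k : ℤ, P.map (fun ω t => Y (t + k) ω) = P.map (fun ω t => Y t ω)
  transition : ∀ (t : ℤ) (e : E),
    P[(Y t ⁻¹' {e}).indicator (fun _ => (1 : ℝ)) | MeasurableSpace.comap (past Y t) inferInstance]
      =ᵐ[P] fun ω => (q (past Y t ω)).real {e}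

end CompleteConnections

end

/-
Let `T` be the transition operator of the Markov chain of pasts. Coupling maximally the letters
added to two pasts shows that, if `f` varies by at most `w m` between pasts sharing `m` letters,
then `T f` varies by at most `P w m`, where `P` is the transition operator of the house-of-cards
chain `(S_n)`. For a function `f` of the newest letter with values in `[0, 1]`, the variation of
`Tⁿ f` is therefore at most `P(S_n = 0)`. If `μ` and `μbar` are invariant for `q` and `qbar`, then
`μbar f - μ f` is the sum over `n` of `μbar ((Tbar - T) Tⁿ f)`, each term of which is at most
`P(S_n = 0)` times the largest total variation distance between `q` and `qbar`. The series
converges because `(S_n)` is transient, and the same contraction with `qbar = q` gives uniqueness.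
Invariant laws of the past exist by the Krylov–Bogoliubov argument, `T` being Feller, and extend to
stationary processes indexed by `ℤ` by compactness.
-/

noncomputable section

namespace CompleteConnections

section HouseOfCards

/-- The transition operator `w ↦ P w` of the house-of-cards chain: the expectation of `w` after one
step from `m`. -/
def houseStep (b w : ℕ → ℝ) (m : ℕ) : ℝ := (1 - b m) * w (m + 1) + b m * w 0

variable {b w : ℕ → ℝ}

lemma antitone_houseStep (hb1 : ∀ m, b m ≤ 1) (hb : Antitone b) (hw : Antitone w) :
    Antitone (houseStep b w) := by
  refine antitone_nat_of_succ_le fun m ↦ ?_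
  have hb' : b (m + 1) ≤ b m := hb m.le_succ
  have hw' : w (m + 1) ≤ w 0 := hw m.succ.zero_le
  calc houseStep b w (m + 1)
      ≤ (1 - b (m + 1)) * w (m + 1) + b (m + 1) * w 0 := by
        have := sub_nonneg.2 (hb1 (m + 1))
        unfold houseStep
        gcongr
        exact hw (m + 1).le_succ
    _ = w (m + 1) + b (m + 1) * (w 0 - w (m + 1)) := by ring
    _ ≤ w (m + 1) + b m * (w 0 - w (m + 1)) := by
        have := sub_nonneg.2 hw'
        gcongr
    _ = houseStep b w m := by
        unfold houseStep
        ring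

lemma antitone_houseStep_iterate (hb1 : ∀ m, b m ≤ 1) (hb : Antitone b) (hw : Antitone w) (n : ℕ) :
    Antitone ((houseStep b)^[n] w) := by
  induction n with
  | zero => exact hw
  | succ n ih =>
    rw [Function.iterate_succ_apply']
    exact antitone_houseStep hb1 hb ih

variable (b w)

lemma houseLaw_eq_zero_of_lt {n j : ℕ} (h : n < j) : houseLaw b n j = 0 := by
  induction n generalizing j with
  | zero => simp [houseLaw, h.ne']
  | succ n ih =>
    rw [houseLaw]
    refine (tsum_congr fun i ↦ ?_).trans tsum_zero
    rcases lt_or_ge n i with hi | hi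
    · rw [ih hi, zero_mul]
    · rw [houseMatrix, if_neg (by lia), if_neg (by lia), mul_zero]

lemma houseLaw_succ_succ (n j : ℕ) :
    houseLaw b (n + 1) (j + 1) = houseLaw b n j * (1 - b j) := by
  rw [houseLaw, tsum_eq_single j]
  · simp [houseMatrix]
  · intro i hi
    rw [houseMatrix, if_neg (by lia), if_neg (by lia), mul_zero]

lemma houseLaw_succ_zero (n : ℕ) :
    houseLaw b (n + 1) 0 = ∑ i ∈ Finset.range (n + 1), houseLaw b n i * b i := by
  have h : ∀ i, houseMatrix b i 0 = b i := fun i ↦ by simp [houseMatrix]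
  simp_rw [houseLaw, h]
  refine tsum_eq_sum fun i hi ↦ ?_
  rw [houseLaw_eq_zero_of_lt b (by simpa using hi), zero_mul]

lemma sum_houseLaw_succ_mul (n : ℕ) :
    ∑ j ∈ Finset.range (n + 2), houseLaw b (n + 1) j * w j =
      ∑ j ∈ Finset.range (n + 1), houseLaw b n j * houseStep b w j := by
  rw [Finset.sum_range_succ', houseLaw_succ_zero, Finset.sum_mul, ← Finset.sum_add_distrib]
  refine Finset.sum_congr rfl fun j _ ↦ ?_
  rw [houseLaw_succ_succ, houseStep]
  ring

lemma houseStep_iterate_apply_zero (n : ℕ) :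
    (houseStep b)^[n] w 0 = ∑ j ∈ Finset.range (n + 1), houseLaw b n j * w j := by
  induction n generalizing w with
  | zero => simp [houseLaw]
  | succ n ih => rw [Function.iterate_succ_apply, ih, sum_houseLaw_succ_mul]

lemma sum_houseLaw (n : ℕ) : ∑ j ∈ Finset.range (n + 1), houseLaw b n j = 1 := by
  have hfix : houseStep b (fun _ ↦ 1) = fun _ ↦ 1 := by
    ext m
    simp [houseStep]
  have h := houseStep_iterate_apply_zero b (fun _ ↦ 1) n
  rw [Function.iterate_fixed hfix] at h
  simpa using h.symm

lemma houseLaw_add (n j : ℕ) :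
    houseLaw b (n + j) j = houseLaw b n 0 * ∏ i ∈ Finset.range j, (1 - b i) := by
  induction j with
  | zero => simp
  | succ j ih => rw [← add_assoc, houseLaw_succ_succ, ih, Finset.prod_range_succ, mul_assoc]

variable {b w}

lemma houseLaw_nonneg (hb0 : ∀ m, 0 ≤ b m) (hb1 : ∀ m, b m ≤ 1) (n j : ℕ) :
    0 ≤ houseLaw b n j := by
  induction n generalizing j with
  | zero =>
    rw [houseLaw]
    positivity
  | succ n ih =>
    cases j with
    | zero =>
      rw [houseLaw_succ_zero]
      exact Finset.sum_nonneg fun i _ ↦ mul_nonneg (ih i) (hb0 i)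
    | succ j =>
      rw [houseLaw_succ_succ]
      exact mul_nonneg (ih j) (sub_nonneg.2 (hb1 j))

lemma exists_pos_forall_le_prod_one_sub (hb0 : ∀ m, 0 ≤ b m) (hb1 : ∀ m, b m < 1)
    (hb : Summable b) : ∃ p > 0, ∀ n, p ≤ ∏ i ∈ Finset.range n, (1 - b i) := by
  have hlim : Tendsto (fun n ↦ ∏ i ∈ Finset.range n, (1 - b i)) atTop (𝓝 (∏' i, (1 - b i))) := by
    simpa [sub_eq_add_neg] using
      (Real.multipliable_one_add_of_summable hb.neg).hasProd.tendsto_prod_nat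
  have hne : ∏' i, (1 - b i) ≠ 0 := by
    simpa [sub_eq_add_neg] using tprod_one_add_ne_zero_of_summable (f := fun i ↦ -b i)
      (fun i ↦ by linarith [hb1 i]) hb.neg.norm
  have hnonneg : ∀ n, 0 ≤ ∏ i ∈ Finset.range n, (1 - b i) := fun n ↦
    Finset.prod_nonneg fun i _ ↦ sub_nonneg.2 (hb1 i).le
  have hanti : Antitone fun n ↦ ∏ i ∈ Finset.range n, (1 - b i) :=
    antitone_nat_of_succ_le fun n ↦ by
      rw [Finset.prod_range_succ]
      exact mul_le_of_le_one_right (hnonneg n) (sub_le_self _ (hb0 n))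
  exact ⟨_, (ge_of_tendsto' hlim hnonneg).lt_of_ne' hne, hanti.le_of_tendsto hlim⟩

/- Renewal argument: decomposing according to the last visit to `0` before time `n`, the expected
number of visits to `0` times the probability of never returning there is at most `1`. -/
lemma summable_houseLaw_zero (hb0 : ∀ m, 0 ≤ b m) (hb1 : ∀ m, b m < 1) (hb : Summable b) :
    Summable fun n ↦ houseLaw b n 0 := by
  obtain ⟨p, hp, hprod⟩ := exists_pos_forall_le_prod_one_sub hb0 hb1 hb
  have hnonneg := houseLaw_nonneg hb0 fun m ↦ (hb1 m).le
  refine summable_of_sum_range_le (c := 1 / p) (fun n ↦ hnonneg n 0) fun n ↦ ?_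
  rw [le_div_iff₀ hp]
  calc (∑ k ∈ Finset.range n, houseLaw b k 0) * p
      ≤ (∑ k ∈ Finset.range (n + 1), houseLaw b k 0) * p := by
        gcongr
        · exact fun k _ _ ↦ hnonneg k 0
        · exact n.le_succ
    _ = ∑ j ∈ Finset.range (n + 1), houseLaw b (n - j) 0 * p := by
        rw [Finset.sum_mul, ← Finset.sum_range_reflect]
        simp
    _ ≤ ∑ j ∈ Finset.range (n + 1), houseLaw b n j := by
        refine Finset.sum_le_sum fun j hj ↦ ?_
        have hlaw := houseLaw_add b (n - j) j
        rw [Nat.sub_add_cancel (Nat.lt_succ_iff.1 (Finset.mem_range.1 hj))] at hlaw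
        rw [hlaw]
        exact mul_le_mul_of_nonneg_left (hprod j) (hnonneg _ _)
    _ = 1 := sum_houseLaw b n

lemma tendsto_houseLaw (hu : Tendsto (fun n ↦ houseLaw b n 0) atTop (𝓝 0)) (j : ℕ) :
    Tendsto (fun n ↦ houseLaw b n j) atTop (𝓝 0) := by
  rw [← tendsto_add_atTop_iff_nat j]
  simp_rw [houseLaw_add]
  simpa using hu.mul_const (∏ i ∈ Finset.range j, (1 - b i))

lemma tendsto_houseStep_iterate_apply_zero (hu : Tendsto (fun n ↦ houseLaw b n 0) atTop (𝓝 0))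
    {k : ℕ} (hw : ∀ j, k ≤ j → w j = 0) :
    Tendsto (fun n ↦ (houseStep b)^[n] w 0) atTop (𝓝 0) := by
  have h : Tendsto (fun n ↦ ∑ j ∈ Finset.range k, houseLaw b n j * w j) atTop (𝓝 0) := by
    simpa using tendsto_finsetSum (Finset.range k) fun j _ ↦
      (tendsto_houseLaw hu j).mul_const (w j)
  refine h.congr' ?_
  filter_upwards [eventually_ge_atTop k] with n hn
  rw [houseStep_iterate_apply_zero]
  refine Finset.sum_subset (Finset.range_mono (by lia)) fun j _ hj ↦ ?_
  rw [hw j (by simpa using hj), mul_zero]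

lemma summable_bStar (hu : Summable fun n ↦ houseLaw b n 0) : Summable (bStar b) := by
  rw [← summable_nat_add_iff 1] at hu ⊢
  simpa [bStar] using hu

lemma tsum_houseLaw_zero (hu : Summable fun n ↦ houseLaw b n 0) :
    ∑' n, houseLaw b n 0 = 1 + ∑' n, bStar b (n + 1) := by
  rw [hu.tsum_eq_zero_add]
  simp [houseLaw, bStar]

lemma tsum_houseLaw_zero_le (hb0 : 0 ≤ b 0) (hu : Summable fun n ↦ houseLaw b n 0) :
    ∑' n, houseLaw b n 0 ≤ 1 + ∑' n, bStar b n := by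
  have hbStar0 : 0 ≤ bStar b 0 := hb0
  rw [tsum_houseLaw_zero hu, (summable_bStar hu).tsum_eq_zero_add]
  linarith

lemma houseLaw_zero_of_eq_zero (hb : ∀ m, 1 ≤ m → b m = 0) (n : ℕ) :
    houseLaw b n 0 = b 0 ^ n := by
  induction n with
  | zero => simp [houseLaw]
  | succ n ih =>
    rw [houseLaw_succ_zero, Finset.sum_range_succ', ih, pow_succ]
    simp [hb]

lemma tsum_houseLaw_zero_of_eq_zero (hb : ∀ m, 1 ≤ m → b m = 0) (h0 : 0 ≤ b 0) (h1 : b 0 < 1) :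
    ∑' n, houseLaw b n 0 = (1 - b 0)⁻¹ := by
  simp_rw [houseLaw_zero_of_eq_zero hb]
  exact tsum_geometric_of_lt_one h0 h1

end HouseOfCards

section TotalVariation

variable {E : Type*} [Fintype E] [MeasurableSpace E]

lemma dTV_self (ν : Measure E) : dTV ν ν = 0 := by simp [dTV]

lemma dTV_nonneg (ν ν' : Measure E) : 0 ≤ dTV ν ν' := by
  unfold dTV
  positivity

lemma dTV_comm (ν ν' : Measure E) : dTV ν ν' = dTV ν' ν := by simp [dTV, abs_sub_comm]

lemma abs_measureReal_singleton_sub_le (ν ν' : Measure E) (e : E) :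
    |ν.real {e} - ν'.real {e}| ≤ 2 * dTV ν ν' := by
  have h := Finset.single_le_sum (f := fun e ↦ |ν.real {e} - ν'.real {e}|)
    (fun _ _ ↦ abs_nonneg _) (Finset.mem_univ e)
  unfold dTV
  linarith

lemma contCoeff_nonneg (q : Kernel (ℕ → E) E) (m : ℕ) : 0 ≤ contCoeff q m :=
  Real.sSup_nonneg <| by
    rintro _ ⟨y, y', -, rfl⟩
    exact dTV_nonneg _ _

lemma contCoeff_le (q : Kernel (ℕ → E) E) {m : ℕ} {r : ℝ} (hr : 0 ≤ r)
    (h : ∀ y y' : ℕ → E, (∀ i < m, y i = y' i) → dTV (q y) (q y') ≤ r) : contCoeff q m ≤ r :=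
  Real.sSup_le (by rintro _ ⟨y, y', hy, rfl⟩; exact h y y' hy) hr

variable [DiscreteMeasurableSpace E]

section Measure

variable (ν ν' : Measure E) [IsProbabilityMeasure ν] [IsProbabilityMeasure ν']

lemma sum_min_measureReal_singleton : ∑ e, min (ν.real {e}) (ν'.real {e}) = 1 - dTV ν ν' := by
  simp_rw [inf_eq_half_smul_add_sub_abs_sub' ℝ, abs_sub_comm (ν'.real _), ← Finset.smul_sum,
    Finset.sum_sub_distrib, Finset.sum_add_distrib]
  simp [dTV]
  ring

lemma sum_measureReal_singleton_sub_min :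
    ∑ e, (ν.real {e} - min (ν.real {e}) (ν'.real {e})) = dTV ν ν' := by
  simp [Finset.sum_sub_distrib, sum_min_measureReal_singleton]

lemma dTV_le_one : dTV ν ν' ≤ 1 := by
  rw [← sub_nonneg, ← sum_min_measureReal_singleton]
  positivity

lemma exists_dTV_eq_measureReal_sub : ∃ A : Set E, dTV ν ν' = ν.real A - ν'.real A := by
  classical
  refine ⟨({e | ν'.real {e} ≤ ν.real {e}} : Finset E), ?_⟩
  simp_rw [← sum_measureReal_singleton, ← Finset.sum_sub_distrib, Finset.sum_filter,
    ← sum_measureReal_singleton_sub_min]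
  refine Finset.sum_congr rfl fun e _ ↦ ?_
  split_ifs with h
  · rw [min_eq_right h]
  · rw [min_eq_left (le_of_not_ge h), sub_self]

/- The bound obtained from a maximal coupling of `ν` and `ν'`: the two coordinates agree with
probability `1 - dTV ν ν'`. -/
lemma integral_sub_integral_le_dTV {f f' : E → ℝ} {c C : ℝ} (hc : ∀ e, f e - f' e ≤ c)
    (hC : ∀ e e', f e - f' e' ≤ C) :
    ∫ e, f e ∂ν - ∫ e, f' e ∂ν' ≤ (1 - dTV ν ν') * c + dTV ν ν' * C := by
  have : Nonempty E := ν.nonempty_of_neZero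
  obtain ⟨e₁, hf⟩ := Finite.exists_max f
  have hf' : ∀ e, f e₁ - C ≤ f' e := fun e ↦ by linarith [hC e₁ e]
  let m := fun e ↦ min (ν.real {e}) (ν'.real {e})
  have hterm : ∀ e, ν.real {e} * f e - ν'.real {e} * f' e ≤
      m e * c + (ν.real {e} - m e) * f e₁ - (ν'.real {e} - m e) * (f e₁ - C) := fun e ↦ by
    have h₁ : m e * (f e - f' e) ≤ m e * c := by
      gcongr
      exact hc e
    have h₂ : (ν.real {e} - m e) * f e ≤ (ν.real {e} - m e) * f e₁ :=
      mul_le_mul_of_nonneg_left (hf e) (sub_nonneg.2 (min_le_left _ _))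
    have h₃ : (ν'.real {e} - m e) * (f e₁ - C) ≤ (ν'.real {e} - m e) * f' e :=
      mul_le_mul_of_nonneg_left (hf' e) (sub_nonneg.2 (min_le_right _ _))
    linarith
  have hm : ∑ e, m e = 1 - dTV ν ν' := sum_min_measureReal_singleton ν ν'
  rw [integral_fintype .of_finite, integral_fintype .of_finite, ← Finset.sum_sub_distrib]
  calc ∑ e, (ν.real {e} * f e - ν'.real {e} * f' e)
      ≤ ∑ e, (m e * c + (ν.real {e} - m e) * f e₁ - (ν'.real {e} - m e) * (f e₁ - C)) :=
        Finset.sum_le_sum fun e _ ↦ hterm e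
    _ = (1 - dTV ν ν') * c + dTV ν ν' * f e₁ - dTV ν ν' * (f e₁ - C) := by
        simp_rw [Finset.sum_sub_distrib, Finset.sum_add_distrib, ← Finset.sum_mul,
          Finset.sum_sub_distrib, hm]
        simp
    _ = (1 - dTV ν ν') * c + dTV ν ν' * C := by ring

end Measure

section Kernel

variable (q : Kernel (ℕ → E) E) [IsMarkovKernel q]

lemma dTV_le_contCoeff {m : ℕ} {y y' : ℕ → E} (h : ∀ i < m, y i = y' i) :
    dTV (q y) (q y') ≤ contCoeff q m :=
  le_csSup ⟨1, by rintro _ ⟨y, y', -, rfl⟩; exact dTV_le_one _ _⟩ ⟨y, y', h, rfl⟩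

lemma contCoeff_le_one (m : ℕ) : contCoeff q m ≤ 1 :=
  contCoeff_le q zero_le_one fun _ _ _ ↦ dTV_le_one _ _

lemma antitone_contCoeff : Antitone (contCoeff q) := fun m _ hmn ↦
  contCoeff_le q (contCoeff_nonneg q m) fun _ _ hy ↦
    dTV_le_contCoeff q fun i hi ↦ hy i (hi.trans_le hmn)

end Kernel

end TotalVariation

section TransitionOperator

variable {X : Type*} [MeasurableSpace X]

/-- The transition operator of a kernel, acting on functions: `transOp κ f x` is the expectation
of `f` after one step of `κ` from `x`. -/
def transOp (κ : Kernel X X) (f : X → ℝ) (x : X) : ℝ := ∫ z, f z ∂κ x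

lemma measurable_transOp (κ : Kernel X X) {f : X → ℝ} (hf : Measurable f) :
    Measurable (transOp κ f) :=
  hf.stronglyMeasurable.integral_kernel.measurable

lemma integral_comp_eq_integral_transOp (κ : Kernel X X) (μ : Measure X) {f : X → ℝ}
    (hf : Integrable f (κ ∘ₘ μ)) : ∫ x, f x ∂(κ ∘ₘ μ) = ∫ x, transOp κ f x ∂μ := by
  have hconst : (κ ∘ₖ Kernel.const Unit μ) () = κ ∘ₘ μ := by
    rw [Kernel.comp_apply, Kernel.const_apply]
  rw [← hconst] at hf ⊢
  rw [Kernel.integral_comp hf, Kernel.const_apply]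
  rfl

lemma integral_transOp_of_invariant {κ : Kernel X X} {μ : Measure X} (hμ : κ.Invariant μ)
    {f : X → ℝ} (hf : Integrable f μ) : ∫ x, transOp κ f x ∂μ = ∫ x, f x ∂μ := by
  rw [← integral_comp_eq_integral_transOp κ μ (by rwa [hμ.def]), hμ.def]

end TransitionOperator

section PastKernel

variable {E : Type*} [MeasurableSpace E]

/-- Adding a new letter to a past: the pair `(y, e)` is sent to `(e, y 0, y 1, …)`. -/
def pastCons : (ℕ → E) × E ≃ᵐ (ℕ → E) where
  toFun p n := Nat.casesOn n p.2 p.1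
  invFun y := (fun n ↦ y (n + 1), y 0)
  left_inv _ := rfl
  right_inv y := by
    ext n
    cases n <;> rfl
  measurable_toFun := by
    refine measurable_pi_iff.2 fun n ↦ ?_
    cases n with
    | zero => exact measurable_snd
    | succ n => exact (measurable_pi_apply n).comp measurable_fst
  measurable_invFun := by
    change Measurable fun y : ℕ → E ↦ ((fun n ↦ y (n + 1) : ℕ → E), y 0)
    fun_prop

/-- The transition kernel of the Markov chain of the pasts: from `y` it moves to
`(e, y 0, y 1, …)`, where the new letter `e` has law `q y`. -/
def pastKernel (q : Kernel (ℕ → E) E) : Kernel (ℕ → E) (ℕ → E) :=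
  (Kernel.id ×ₖ q).map pastCons

variable (q : Kernel (ℕ → E) E) [IsMarkovKernel q]

instance : IsMarkovKernel (pastKernel q) := Kernel.IsMarkovKernel.map _ pastCons.measurable

lemma pastKernel_comp_eq_map_compProd (μ : Measure (ℕ → E)) [SFinite μ] :
    pastKernel q ∘ₘ μ = (μ ⊗ₘ q).map pastCons := by
  rw [Measure.compProd_eq_comp_prod, Measure.map_comp _ _ pastCons.measurable, pastKernel]

lemma transOp_pastKernel_apply {f : (ℕ → E) → ℝ} (hf : Measurable f) (y : ℕ → E) :
    transOp (pastKernel q) f y = ∫ e, f (pastCons (y, e)) ∂q y := by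
  rw [transOp, pastKernel, Kernel.map_apply _ pastCons.measurable, Kernel.prod_apply,
    Kernel.id_apply, Measure.dirac_prod, integral_map_equiv]
  exact integral_map measurable_prodMk_left.aemeasurable
    (hf.comp pastCons.measurable).aestronglyMeasurable

variable {q} in
lemma map_tail_of_invariant {μ : Measure (ℕ → E)} [SFinite μ]
    (hμ : (pastKernel q).Invariant μ) : μ.map (fun y n ↦ y (n + 1)) = μ := by
  have htail : Measurable fun (y : ℕ → E) n ↦ y (n + 1) := by fun_prop
  nth_rw 1 [← hμ.def]
  rw [pastKernel_comp_eq_map_compProd, Measure.map_map htail pastCons.measurable]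
  exact Measure.fst_compProd μ q

end PastKernel

section Variation

variable {E : Type*} [MeasurableSpace E]

/-- `f` is a measurable function of the past which varies by at most `w m` between two pasts that
share their `m` newest letters. The one-sided bound suffices, the condition on the pasts being
symmetric. -/
structure HasVariationLE (f : (ℕ → E) → ℝ) (w : ℕ → ℝ) : Prop where
  measurable : Measurable f
  sub_le : ∀ (m : ℕ) (y y' : ℕ → E), (∀ i < m, y i = y' i) → f y - f y' ≤ w m

lemma hasVariationLE_indicator {s : Set (ℕ → E)} (hs : MeasurableSet s) {k : ℕ}
    (hsk : DependsOn (· ∈ s) (Set.Iio k)) :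
    HasVariationLE (s.indicator 1) ((Set.Iio k).indicator 1) where
  measurable := measurable_one.indicator hs
  sub_le m y y' hy := by
    by_cases hm : m < k
    · have h₁ : s.indicator 1 y ≤ (1 : ℝ) := Set.indicator_le_self' (by simp) y
      have h₂ : (0 : ℝ) ≤ s.indicator 1 y' := Set.indicator_nonneg (by simp) y'
      simp only [Set.mem_Iio, hm, Set.indicator_of_mem, Pi.one_apply]
      linarith
    · have hys : y ∈ s ↔ y' ∈ s := (hsk fun i hi ↦ hy i (by grind)).to_iff
      by_cases hmem : y' ∈ s <;> simp [hys, hmem, hm]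

lemma antitone_indicator_Iio_one (k : ℕ) : Antitone ((Set.Iio k).indicator (1 : ℕ → ℝ)) := by
  intro i j hij
  by_cases hj : j < k
  · simp [hj, hij.trans_lt hj]
  · simpa [hj] using Set.indicator_nonneg (by simp) i

namespace HasVariationLE

variable {f : (ℕ → E) → ℝ} {w : ℕ → ℝ}

lemma integrable (hf : HasVariationLE f w) (μ : Measure (ℕ → E)) [IsProbabilityMeasure μ] :
    Integrable f μ := by
  obtain ⟨y₀⟩ := μ.nonempty_of_neZero
  refine .of_mem_Icc (f y₀ - w 0) (f y₀ + w 0) hf.measurable.aemeasurable (ae_of_all _ fun y ↦ ?_)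
  have h₁ := hf.sub_le 0 y y₀ (by simp)
  have h₂ := hf.sub_le 0 y₀ y (by simp)
  constructor <;> linarith

lemma integral_sub_integral_le (hf : HasVariationLE f w) (μ ν : Measure (ℕ → E))
    [IsProbabilityMeasure μ] [IsProbabilityMeasure ν] :
    ∫ y, f y ∂μ - ∫ y, f y ∂ν ≤ w 0 := by
  obtain ⟨y, hy⟩ := exists_integral_le (hf.integrable μ)
  obtain ⟨y', hy'⟩ := exists_le_integral (hf.integrable ν)
  linarith [hf.sub_le 0 y y' (by simp)]

variable [Fintype E] [DiscreteMeasurableSpace E]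
variable (q : Kernel (ℕ → E) E) [IsMarkovKernel q]

/- Pasts sharing `m` letters are extended by letters drawn from a maximal coupling: with probability
at least `1 - b_m` the extensions share `m + 1` letters, otherwise nothing is left of the
agreement. This is one step of the house-of-cards chain. -/
protected lemma transOp (hf : HasVariationLE f w) (hw : Antitone w) :
    HasVariationLE (transOp (pastKernel q) f) (houseStep (contCoeff q) w) where
  measurable := measurable_transOp _ hf.measurable
  sub_le m y y' hy := by
    rw [transOp_pastKernel_apply q hf.measurable, transOp_pastKernel_apply q hf.measurable]
    have hdTV : dTV (q y) (q y') ≤ contCoeff q m := dTV_le_contCoeff q hy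
    have hagree : ∀ e, ∀ i < m + 1, pastCons (y, e) i = pastCons (y', e) i := fun e i hi ↦ by
      cases i with
      | zero => rfl
      | succ i => exact hy i (by lia)
    calc ∫ e, f (pastCons (y, e)) ∂q y - ∫ e, f (pastCons (y', e)) ∂q y'
        ≤ (1 - dTV (q y) (q y')) * w (m + 1) + dTV (q y) (q y') * w 0 :=
          integral_sub_integral_le_dTV _ _ (fun e ↦ hf.sub_le _ _ _ (hagree e))
            fun e e' ↦ hf.sub_le _ _ _ (by simp)
      _ = w (m + 1) + dTV (q y) (q y') * (w 0 - w (m + 1)) := by ring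
      _ ≤ w (m + 1) + contCoeff q m * (w 0 - w (m + 1)) := by
          have := sub_nonneg.2 (hw (m + 1).zero_le)
          gcongr
      _ = houseStep (contCoeff q) w m := by
          unfold houseStep
          ring

lemma transOp_iterate (hf : HasVariationLE f w) (hw : Antitone w) (n : ℕ) :
    HasVariationLE ((transOp (pastKernel q))^[n] f) ((houseStep (contCoeff q))^[n] w) := by
  induction n generalizing f w with
  | zero => exact hf
  | succ _ ih =>
    exact ih (hf.transOp q hw)
      (antitone_houseStep (contCoeff_le_one q) (antitone_contCoeff q) hw)

lemma transOp_sub_transOp_le (q' : Kernel (ℕ → E) E) [IsMarkovKernel q']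
    (hf : HasVariationLE f w) {y : ℕ → E} {δ : ℝ} (hδ : dTV (q y) (q' y) ≤ δ) :
    transOp (pastKernel q') f y - transOp (pastKernel q) f y ≤ δ * w 0 := by
  have hw0 : 0 ≤ w 0 := by simpa using hf.sub_le 0 y y (by simp)
  rw [transOp_pastKernel_apply q' hf.measurable, transOp_pastKernel_apply q hf.measurable]
  calc ∫ e, f (pastCons (y, e)) ∂q' y - ∫ e, f (pastCons (y, e)) ∂q y
      ≤ (1 - dTV (q' y) (q y)) * 0 + dTV (q' y) (q y) * w 0 :=
        integral_sub_integral_le_dTV _ _ (by simp) fun e e' ↦ hf.sub_le _ _ _ (by simp)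
    _ ≤ δ * w 0 := by
        rw [mul_zero, zero_add, dTV_comm]
        gcongr

end HasVariationLE

end Variation

section Comparison

variable {E : Type*} [MeasurableSpace E]

lemma measure_ext_of_map_restrict {ι : Type*} {μ ν : Measure (ι → E)} [IsFiniteMeasure ν]
    (h : ∀ I : Finset ι, μ.map I.restrict = ν.map I.restrict) : μ = ν :=
  IsProjectiveLimit.unique (P := fun I ↦ ν.map I.restrict) h fun _ ↦ rfl

lemma measure_ext_of_dependsOn_Iio [Countable E] [MeasurableSingletonClass E]
    {μ ν : Measure (ℕ → E)} [IsFiniteMeasure ν]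
    (h : ∀ (k : ℕ) (s : Set (ℕ → E)), MeasurableSet s → DependsOn (· ∈ s) (Set.Iio k) →
      μ s = ν s) : μ = ν := by
  refine measure_ext_of_map_restrict fun I ↦ Measure.ext_of_singleton fun x ↦ ?_
  have hI : Measurable (I.restrict : (ℕ → E) → I → E) := by fun_prop
  rw [Measure.map_apply hI (measurableSet_singleton x),
    Measure.map_apply hI (measurableSet_singleton x)]
  refine h (I.sup id + 1) _ (hI (measurableSet_singleton x)) fun y y' hy ↦ ?_
  have hrestrict : I.restrict y = I.restrict y' := by
    ext i
    exact hy i (Nat.lt_succ_of_le (Finset.le_sup (f := id) i.2))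
  simp [hrestrict]

variable [Fintype E] [DiscreteMeasurableSpace E]
variable {q q' : Kernel (ℕ → E) E} [IsMarkovKernel q] [IsMarkovKernel q']
variable {μ μ' : Measure (ℕ → E)} [IsProbabilityMeasure μ] [IsProbabilityMeasure μ']

/- With `T` and `T'` the transition operators of `q` and `q'`, invariance of `μ'` gives the
telescoping identity `μ' f - μ' (Tⁿ f) = ∑_{k < n} μ' ((T' - T) Tᵏ f)`, and `μ (Tⁿ f) = μ f`. -/
lemma integral_sub_integral_le_of_invariant (hμ : (pastKernel q).Invariant μ)
    (hμ' : (pastKernel q').Invariant μ') {f : (ℕ → E) → ℝ} {w : ℕ → ℝ}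
    (hf : HasVariationLE f w) (hw : Antitone w) {δ : ℝ} (hδ : ∀ y, dTV (q y) (q' y) ≤ δ) (n : ℕ) :
    ∫ y, f y ∂μ' - ∫ y, f y ∂μ ≤
      δ * ∑ k ∈ Finset.range n, (houseStep (contCoeff q))^[k] w 0 +
        (houseStep (contCoeff q))^[n] w 0 := by
  set T := transOp (pastKernel q)
  set v := fun k ↦ (houseStep (contCoeff q))^[k] w
  have hvar : ∀ k, HasVariationLE (T^[k] f) (v k) := hf.transOp_iterate q hw
  have hanti : ∀ k, Antitone (v k) :=
    antitone_houseStep_iterate (contCoeff_le_one q) (antitone_contCoeff q) hw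
  have hstep : ∀ k, ∫ y, T^[k] f y ∂μ' - ∫ y, T^[k + 1] f y ∂μ' ≤ δ * v k 0 := fun k ↦ by
    have hint := ((hvar k).transOp q' (hanti k)).integrable μ'
    have hint' := ((hvar k).transOp q (hanti k)).integrable μ'
    rw [← integral_transOp_of_invariant hμ' ((hvar k).integrable μ'),
      Function.iterate_succ_apply', ← integral_sub hint hint']
    simpa using integral_mono (hint.sub hint') (integrable_const (δ * v k 0))
      fun y ↦ (hvar k).transOp_sub_transOp_le q q' (hδ y)
  have hinv : ∀ k, ∫ y, T^[k] f y ∂μ = ∫ y, f y ∂μ := fun k ↦ by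
    induction k with
    | zero => rfl
    | succ k ih =>
      rw [Function.iterate_succ_apply',
        integral_transOp_of_invariant hμ ((hvar k).integrable μ), ih]
  calc ∫ y, f y ∂μ' - ∫ y, f y ∂μ
      = ∑ k ∈ Finset.range n, (∫ y, T^[k] f y ∂μ' - ∫ y, T^[k + 1] f y ∂μ') +
          (∫ y, T^[n] f y ∂μ' - ∫ y, T^[n] f y ∂μ) := by
        rw [Finset.sum_range_sub', hinv n]
        simp
    _ ≤ δ * ∑ k ∈ Finset.range n, v k 0 + v n 0 := by
        rw [Finset.mul_sum]
        gcongr with k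
        · exact hstep k
        · exact (hvar n).integral_sub_integral_le μ' μ

lemma measureReal_sub_le_of_invariant (hμ : (pastKernel q).Invariant μ)
    (hμ' : (pastKernel q').Invariant μ') {s : Set (ℕ → E)} (hs : MeasurableSet s) {k : ℕ}
    (hsk : DependsOn (· ∈ s) (Set.Iio k)) {δ : ℝ} (hδ : ∀ y, dTV (q y) (q' y) ≤ δ) (n : ℕ) :
    μ'.real s - μ.real s ≤
      δ * ∑ j ∈ Finset.range n, (houseStep (contCoeff q))^[j] ((Set.Iio k).indicator 1) 0 +
        (houseStep (contCoeff q))^[n] ((Set.Iio k).indicator 1) 0 := by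
  rw [← integral_indicator_one hs, ← integral_indicator_one hs]
  exact integral_sub_integral_le_of_invariant hμ hμ' (hasVariationLE_indicator hs hsk)
    (antitone_indicator_Iio_one k) hδ n

lemma invariant_unique (hu : Tendsto (fun n ↦ houseLaw (contCoeff q) n 0) atTop (𝓝 0))
    (hμ : (pastKernel q).Invariant μ) (hμ' : (pastKernel q).Invariant μ') : μ = μ' := by
  refine measure_ext_of_dependsOn_Iio fun k s hs hsk ↦ ?_
  have hlim : Tendsto (fun n ↦ (houseStep (contCoeff q))^[n] ((Set.Iio k).indicator 1) 0)
      atTop (𝓝 0) :=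
    tendsto_houseStep_iterate_apply_zero hu fun j (hj : k ≤ j) ↦ by simp [hj]
  have hδ : ∀ y, dTV (q y) (q y) ≤ 0 := fun y ↦ (dTV_self (q y)).le
  have hle : μ'.real s - μ.real s ≤ 0 := ge_of_tendsto' hlim fun n ↦ by
    simpa only [zero_mul, zero_add] using measureReal_sub_le_of_invariant hμ hμ' hs hsk hδ n
  have hge : μ.real s - μ'.real s ≤ 0 := ge_of_tendsto' hlim fun n ↦ by
    simpa only [zero_mul, zero_add] using measureReal_sub_le_of_invariant hμ' hμ hs hsk hδ n
  rw [← measureReal_eq_measureReal_iff]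
  exact le_antisymm (sub_nonpos.1 hge) (sub_nonpos.1 hle)

lemma dTV_map_apply_zero_le_of_invariant (hu : Summable fun n ↦ houseLaw (contCoeff q) n 0)
    (hμ : (pastKernel q).Invariant μ) (hμ' : (pastKernel q').Invariant μ') :
    dTV (μ.map (· 0)) (μ'.map (· 0)) ≤
      (∑' n, houseLaw (contCoeff q) n 0) * ⨆ y, dTV (q y) (q' y) := by
  have hδ : ∀ y, dTV (q y) (q' y) ≤ ⨆ y, dTV (q y) (q' y) :=
    le_ciSup ⟨1, Set.forall_mem_range.2 fun y ↦ dTV_le_one _ _⟩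
  have hzero : Measurable fun y : ℕ → E ↦ y 0 := measurable_pi_apply 0
  have := Measure.isProbabilityMeasure_map (μ := μ) hzero.aemeasurable
  have := Measure.isProbabilityMeasure_map (μ := μ') hzero.aemeasurable
  obtain ⟨A, hA⟩ := exists_dTV_eq_measureReal_sub (μ'.map (· 0)) (μ.map (· 0))
  have hs : MeasurableSet ((· 0) ⁻¹' A : Set (ℕ → E)) := hzero .of_discrete
  have hsk : DependsOn (· ∈ ((· 0) ⁻¹' A : Set (ℕ → E))) (Set.Iio 1) := fun y y' hy ↦ by
    simp [hy 0 (by simp)]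
  have hlaw : ∀ n, (houseStep (contCoeff q))^[n] ((Set.Iio 1).indicator 1) 0 =
      houseLaw (contCoeff q) n 0 := fun n ↦ by
    simp [houseStep_iterate_apply_zero, Finset.sum_range_succ']
  have hlim := (hu.hasSum.tendsto_sum_nat.const_mul (⨆ y, dTV (q y) (q' y))).add
    hu.tendsto_atTop_zero
  rw [add_zero] at hlim
  rw [dTV_comm, hA, map_measureReal_apply hzero .of_discrete,
    map_measureReal_apply hzero .of_discrete, mul_comm]
  exact ge_of_tendsto' hlim fun n ↦ by
    simpa only [hlaw] using measureReal_sub_le_of_invariant hμ hμ' hs hsk hδ n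

end Comparison

section KrylovBogoliubov

open scoped BoundedContinuousFunction

variable {X : Type*} [MeasurableSpace X]

/-- The average of the laws at the times `0, …, n` of the Markov chain with kernel `κ` started
from `x`. -/
def cesaroLaw (κ : Kernel X X) (x : X) (n : ℕ) : Measure X :=
  ((n + 1 : ℕ) : ENNReal)⁻¹ • ∑ k ∈ Finset.range (n + 1), (κ ∘ₘ ·)^[k] (Measure.dirac x)

variable (κ : Kernel X X) (x : X)

lemma integral_cesaroLaw (n : ℕ) {f : X → ℝ}
    (hf : ∀ k, Integrable f ((κ ∘ₘ ·)^[k] (Measure.dirac x))) :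
    ∫ z, f z ∂cesaroLaw κ x n =
      ((n + 1 : ℕ) : ℝ)⁻¹ *
        ∑ k ∈ Finset.range (n + 1), ∫ z, f z ∂(κ ∘ₘ ·)^[k] (Measure.dirac x) := by
  rw [cesaroLaw, integral_smul_measure, integral_finsetSum_measure fun k _ ↦ hf k,
    ENNReal.toReal_inv, ENNReal.toReal_natCast, smul_eq_mul]

variable [IsMarkovKernel κ]

lemma isProbabilityMeasure_iterate_comp_dirac (n : ℕ) :
    IsProbabilityMeasure ((κ ∘ₘ ·)^[n] (Measure.dirac x)) := by
  induction n with
  | zero => exact Measure.dirac.isProbabilityMeasure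
  | succ n ih =>
    rw [Function.iterate_succ_apply']
    infer_instance

instance (n : ℕ) : IsProbabilityMeasure (cesaroLaw κ x n) where
  measure_univ := by
    have := isProbabilityMeasure_iterate_comp_dirac κ x
    simp only [cesaroLaw, Measure.smul_apply, Measure.finsetSum_apply, measure_univ,
      Finset.sum_const, Finset.card_range, nsmul_eq_mul, mul_one, smul_eq_mul]
    exact ENNReal.inv_mul_cancel (by simp) (ENNReal.natCast_ne_top _)

lemma abs_integral_transOp_sub_integral_cesaroLaw_le (n : ℕ) {f : X → ℝ} (hf : Measurable f)
    {C : ℝ} (hC : ∀ z, ‖f z‖ ≤ C) :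
    |∫ z, transOp κ f z ∂cesaroLaw κ x n - ∫ z, f z ∂cesaroLaw κ x n| ≤
      ((n + 1 : ℕ) : ℝ)⁻¹ * (2 * C) := by
  set μ := fun k ↦ (κ ∘ₘ ·)^[k] (Measure.dirac x)
  have hμ : ∀ k, IsProbabilityMeasure (μ k) := isProbabilityMeasure_iterate_comp_dirac κ x
  have hint : ∀ k, Integrable f (μ k) := fun k ↦
    .of_bound hf.aestronglyMeasurable C (ae_of_all _ hC)
  have hbound : ∀ k, |∫ z, f z ∂μ k| ≤ C := fun k ↦ by
    simpa using norm_integral_le_of_norm_le_const (μ := μ k) (ae_of_all _ hC)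
  have hsucc : ∀ k, ∫ z, transOp κ f z ∂μ k = ∫ z, f z ∂μ (k + 1) := fun k ↦ by
    simp only [μ, Function.iterate_succ_apply']
    refine (integral_comp_eq_integral_transOp κ _ ?_).symm
    simpa only [μ, Function.iterate_succ_apply'] using hint (k + 1)
  have htransOp : ∀ k, Integrable (transOp κ f) (μ k) := fun k ↦
    .of_bound (measurable_transOp κ hf).aestronglyMeasurable C (ae_of_all _ fun z ↦ by
      simpa [transOp] using norm_integral_le_of_norm_le_const (μ := κ z) (ae_of_all _ hC))
  rw [integral_cesaroLaw κ x n hint, integral_cesaroLaw κ x n htransOp, ← mul_sub,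
    Finset.sum_congr rfl fun k _ ↦ hsucc k, ← Finset.sum_sub_distrib,
    Finset.sum_range_sub (fun k ↦ ∫ z, f z ∂μ k), abs_mul, abs_of_nonneg (by positivity)]
  gcongr
  exact (abs_sub _ _).trans (by linarith [hbound (n + 1), hbound 0])

lemma exists_invariant_of_continuous_transOp [TopologicalSpace X] [CompactSpace X] [T2Space X]
    [BorelSpace X] [HasOuterApproxClosed X] [Nonempty X]
    (hκ : ∀ f : X → ℝ, Continuous f → Continuous (transOp κ f)) :
    ∃ μ : Measure X, IsProbabilityMeasure μ ∧ κ.Invariant μ := by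
  obtain ⟨x⟩ := ‹Nonempty X›
  let ν : ℕ → ProbabilityMeasure X := fun n ↦ ⟨cesaroLaw κ x n, inferInstance⟩
  let μ : ProbabilityMeasure X := ((hyperfilter ℕ).map ν).lim
  have hlim : Tendsto ν (hyperfilter ℕ) (𝓝 μ) := ((hyperfilter ℕ).map ν).le_nhds_lim
  have hlim' : ∀ g : X →ᵇ ℝ, Tendsto (fun n ↦ ∫ z, g z ∂cesaroLaw κ x n) (hyperfilter ℕ)
      (𝓝 (∫ z, g z ∂μ)) :=
    ProbabilityMeasure.tendsto_iff_forall_integral_tendsto.1 hlim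
  refine ⟨μ, inferInstance, ext_of_forall_integral_eq_of_IsFiniteMeasure fun f ↦ ?_⟩
  let g : X →ᵇ ℝ := .mkOfCompact ⟨transOp κ f, hκ f f.continuous⟩
  have hzero : Tendsto (fun n : ℕ ↦ ((n + 1 : ℕ) : ℝ)⁻¹ * (2 * ‖f‖)) atTop (𝓝 0) := by
    simpa using ((tendsto_add_atTop_iff_nat 1).2
      (tendsto_inv_atTop_nhds_zero_nat (𝕜 := ℝ))).mul_const (2 * ‖f‖)
  have hdiff : Tendsto (fun n ↦ ∫ z, g z ∂cesaroLaw κ x n - ∫ z, f z ∂cesaroLaw κ x n)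
      (hyperfilter ℕ) (𝓝 0) :=
    (squeeze_zero_norm (fun n ↦ abs_integral_transOp_sub_integral_cesaroLaw_le κ x n
      f.continuous.measurable f.norm_coe_le_norm) hzero).mono_left Nat.hyperfilter_le_atTop
  rw [integral_comp_eq_integral_transOp κ _ (f.integrable _)]
  exact sub_eq_zero.1 (tendsto_nhds_unique ((hlim' g).sub (hlim' f)) hdiff)

end KrylovBogoliubov

section Existence

variable {E : Type*} [MeasurableSpace E] [DiscreteMeasurableSpace E] [Fintype E]

section Feller

variable [TopologicalSpace E] [DiscreteTopology E] {q : Kernel (ℕ → E) E}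

lemma continuous_measureReal_singleton [IsMarkovKernel q]
    (hb : Tendsto (contCoeff q) atTop (𝓝 0)) (e : E) : Continuous fun y ↦ (q y).real {e} := by
  refine continuous_iff_continuousAt.2 fun y ↦ Metric.tendsto_nhds.2 fun ε hε ↦ ?_
  obtain ⟨m, hm⟩ := (hb.eventually_lt_const (half_pos hε)).exists
  have hagree : ∀ᶠ y' in 𝓝 y, ∀ i < m, y' i = y i := by
    refine (Set.finite_Iio m).eventually_all.2 fun i _ ↦ ?_
    simpa [nhds_discrete] using (continuous_apply i).tendsto y
  filter_upwards [hagree] with y' hy'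
  calc dist ((q y').real {e}) ((q y).real {e})
      ≤ 2 * dTV (q y') (q y) := abs_measureReal_singleton_sub_le _ _ e
    _ ≤ 2 * contCoeff q m := by
        gcongr
        exact dTV_le_contCoeff q hy'
    _ < ε := by linarith

lemma continuous_transOp_pastKernel [IsMarkovKernel q] (hb : Tendsto (contCoeff q) atTop (𝓝 0))
    {f : (ℕ → E) → ℝ} (hf : Continuous f) : Continuous (transOp (pastKernel q) f) := by
  have hcons : ∀ e : E, Continuous fun y : ℕ → E ↦ pastCons (y, e) := fun e ↦
    continuous_pi fun n ↦ by
      cases n with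
      | zero => exact continuous_const
      | succ n => exact continuous_apply n
  have hsum : transOp (pastKernel q) f = fun y ↦ ∑ e, (q y).real {e} * f (pastCons (y, e)) := by
    ext y
    rw [transOp_pastKernel_apply q hf.measurable, integral_fintype .of_finite]
    rfl
  rw [hsum]
  exact continuous_finsetSum _ fun e _ ↦
    (continuous_measureReal_singleton hb e).mul (hf.comp (hcons e))

end Feller

lemma exists_invariant_pastKernel [Nonempty E] {q : Kernel (ℕ → E) E} [IsMarkovKernel q]
    (hb : Tendsto (contCoeff q) atTop (𝓝 0)) :
    ∃ μ : Measure (ℕ → E), IsProbabilityMeasure μ ∧ (pastKernel q).Invariant μ := by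
  let _ : TopologicalSpace E := ⊥
  have : DiscreteTopology E := ⟨rfl⟩
  exact exists_invariant_of_continuous_transOp _ fun _ ↦ continuous_transOp_pastKernel hb

end Existence

section Past

variable {Ω E : Type*}

lemma past_add_apply (Y : ℤ → Ω → E) (s t : ℤ) : past (fun r ↦ Y (r + s)) t = past Y (t + s) := by
  ext ω j
  exact congrArg (Y · ω) (by lia)

variable [MeasurableSpace E]

lemma past_add_one (Y : ℤ → Ω → E) (t : ℤ) (ω : Ω) :
    past Y (t + 1) ω = pastCons (past Y t ω, Y t ω) := by
  ext j
  cases j with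
  | zero => exact congrArg (Y · ω) (by lia)
  | succ j => exact congrArg (Y · ω) (by lia)

variable [MeasurableSpace Ω]

lemma measurable_past {Y : ℤ → Ω → E} (hY : ∀ t, Measurable (Y t)) (t : ℤ) :
    Measurable (past Y t) :=
  measurable_pi_iff.2 fun _ ↦ hY _

/-- The past at time `t` of the coordinate process on `ℤ → E`. -/
abbrev coordPast (t : ℤ) : (ℤ → E) → ℕ → E := past (fun t ω ↦ ω t) t

lemma measurable_coordPast (t : ℤ) : Measurable (coordPast (E := E) t) :=
  measurable_past measurable_pi_apply t

lemma map_coordPast_map {P : Measure Ω} {Y : ℤ → Ω → E} (hY : ∀ t, Measurable (Y t)) (t : ℤ) :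
    (P.map fun ω s ↦ Y s ω).map (coordPast t) = P.map (past Y t) :=
  Measure.map_map (measurable_coordPast t) (measurable_pi_iff.2 hY)

lemma measure_ext_of_map_coordPast {ν ν' : Measure (ℤ → E)} [IsFiniteMeasure ν']
    (h : ∀ t, ν.map (coordPast t) = ν'.map (coordPast t)) : ν = ν' := by
  refine measure_ext_of_map_restrict fun I ↦ ?_
  obtain ⟨M, hM⟩ := I.bddAbove
  let r : (ℕ → E) → I → E := fun y i ↦ y (M - i).toNat
  have hr : Measurable r := by fun_prop
  have hfactor : (I.restrict : (ℤ → E) → I → E) = r ∘ coordPast (M + 1) := by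
    ext ω i
    have hi : (i : ℤ) ≤ M := hM i.2
    exact congrArg ω (by lia)
  rw [hfactor, ← Measure.map_map hr (measurable_coordPast _),
    ← Measure.map_map hr (measurable_coordPast _), h]

end Past

section NaturalExtension

variable {E : Type*} [MeasurableSpace E]

lemma map_iterate_tail {μ : Measure (ℕ → E)} (hμ : μ.map (fun y n ↦ y (n + 1)) = μ) (k : ℕ) :
    μ.map (fun y n ↦ y (n + k)) = μ := by
  induction k with
  | zero => exact Measure.map_id
  | succ k ih =>
    nth_rw 2 [← ih]
    nth_rw 2 [← hμ]
    rw [Measure.map_map (by fun_prop) (by fun_prop)]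
    rfl

/- A limit point of the laws of `(y (n - t))_{t ≤ n}` as `n → ∞`, where `y` has law `μ`; the
coordinates after time `n` are irrelevant in the limit. -/
lemma exists_map_coordPast_eq [TopologicalSpace E] [CompactSpace E] [T2Space E]
    [SecondCountableTopology E] [BorelSpace E] {μ : Measure (ℕ → E)} [IsProbabilityMeasure μ]
    (hμ : μ.map (fun y n ↦ y (n + 1)) = μ) :
    ∃ ν : Measure (ℤ → E), IsProbabilityMeasure ν ∧ ∀ t, ν.map (coordPast t) = μ := by
  let φ : ℕ → (ℕ → E) → ℤ → E := fun n y t ↦ y (n - t).toNat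
  have hφ : ∀ n, Measurable (φ n) := fun n ↦ by fun_prop
  have hpast : ∀ t, Continuous (coordPast (E := E) t) := fun t ↦
    continuous_pi fun j ↦ continuous_apply _
  let μ' : ProbabilityMeasure (ℕ → E) := ⟨μ, inferInstance⟩
  let N : ℕ → ProbabilityMeasure (ℤ → E) := fun n ↦ μ'.map (hφ n).aemeasurable
  let ν : ProbabilityMeasure (ℤ → E) := ((hyperfilter ℕ).map N).lim
  have hlim : Tendsto N (hyperfilter ℕ) (𝓝 ν) := ((hyperfilter ℕ).map N).le_nhds_lim
  refine ⟨ν, inferInstance, fun t ↦ ?_⟩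
  have hmap : ∀ n : ℕ, t ≤ n → (N n).map (hpast t).measurable.aemeasurable = μ' := fun n hn ↦ by
    refine Subtype.ext ?_
    calc (μ.map (φ n)).map (coordPast t)
        = μ.map (fun y j ↦ y (j + (n + 1 - t).toNat)) := by
          rw [Measure.map_map (hpast t).measurable (hφ n)]
          congr 1
          ext y j
          exact congrArg y (by lia)
      _ = μ := map_iterate_tail hμ _
  have hmap' : ∀ᶠ n in hyperfilter ℕ, (N n).map (hpast t).measurable.aemeasurable = μ' :=
    Nat.hyperfilter_le_atTop <| (eventually_ge_atTop t.toNat).mono fun n hn ↦ hmap n (by lia)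
  have hν : ν.map (hpast t).measurable.aemeasurable = μ' := tendsto_nhds_unique_of_eventuallyEq
    (ProbabilityMeasure.tendsto_map_of_tendsto_of_continuous N ν hlim (hpast t))
    tendsto_const_nhds hmap'
  exact congrArg ProbabilityMeasure.toMeasure hν

end NaturalExtension

section ConditionalLaw

variable {Ω β E : Type*} [MeasurableSpace Ω] [MeasurableSpace β]

lemma map_prodMk_eq_compProd_iff [MeasurableSpace E] [DiscreteMeasurableSpace E] [Countable E]
    [Nonempty E] {P : Measure Ω} [IsFiniteMeasure P] {X : Ω → β} {Z : Ω → E} (hX : Measurable X)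
    (hZ : Measurable Z) (κ : Kernel β E) [IsFiniteKernel κ] :
    P.map (fun ω ↦ (X ω, Z ω)) = P.map X ⊗ₘ κ ↔
      ∀ e, P[(Z ⁻¹' {e}).indicator (fun _ ↦ (1 : ℝ)) | MeasurableSpace.comap X inferInstance]
        =ᵐ[P] fun ω ↦ (κ (X ω)).real {e} := by
  have hmeas : ∀ (η : Kernel β E) (e : E), Measurable fun x ↦ (η x).real {e} := fun η e ↦
    (η.measurable_coe (measurableSet_singleton e)).ennreal_toReal
  have hext : ∀ x, condDistrib Z X P x = κ x ↔
      ∀ e, (condDistrib Z X P x).real {e} = (κ x).real {e} := fun x ↦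
    Measure.ext_iff_singleton.trans (forall_congr' fun e ↦ (measureReal_eq_measureReal_iff ..).symm)
  have hcond : ∀ e, (fun ω ↦ (condDistrib Z X P (X ω)).real {e}) =ᵐ[P]
      P[(Z ⁻¹' {e}).indicator (fun _ ↦ (1 : ℝ)) | MeasurableSpace.comap X inferInstance] := fun e ↦
    condDistrib_ae_eq_condExp hX hZ (measurableSet_singleton e)
  rw [← condDistrib_ae_eq_iff_measure_eq_compProd X hZ.aemeasurable, EventuallyEq]
  simp_rw [hext, ae_all_iff]
  refine forall_congr' fun e ↦ ?_
  rw [ae_map_iff hX.aemeasurable (measurableSet_eq_fun (hmeas _ e) (hmeas κ e))]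
  exact ⟨(hcond e).symm.trans, (hcond e).trans⟩

end ConditionalLaw

section StationaryChain

variable {Ω E : Type*} [MeasurableSpace Ω] [MeasurableSpace E] {q : Kernel (ℕ → E) E}
variable {P : Measure Ω} {Y : ℤ → Ω → E}

lemma IsStationaryChain.isProbabilityMeasure_map_past (h : IsStationaryChain q P Y) (t : ℤ) :
    IsProbabilityMeasure (P.map (past Y t)) :=
  have := h.isProbabilityMeasure
  Measure.isProbabilityMeasure_map (measurable_past h.measurable t).aemeasurable

lemma IsStationaryChain.map_past_eq (h : IsStationaryChain q P Y) (s t : ℤ) :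
    P.map (past Y (t + s)) = P.map (past Y t) := by
  rw [← past_add_apply, ← map_coordPast_map fun r ↦ h.measurable (r + s), h.stationary s,
    map_coordPast_map h.measurable]

lemma IsStationaryChain.map_apply_zero (h : IsStationaryChain q P Y) :
    (P.map (past Y 1)).map (· 0) = P.map (Y 0) :=
  Measure.map_map (measurable_pi_apply 0) (measurable_past h.measurable 1)

variable [DiscreteMeasurableSpace E] [IsMarkovKernel q]

section Countable

variable [Countable E]

lemma pastKernel_comp_map_past_eq_iff [IsProbabilityMeasure P] (hY : ∀ t, Measurable (Y t))
    (t : ℤ) : pastKernel q ∘ₘ P.map (past Y t) = P.map (past Y (t + 1)) ↔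
      ∀ e, P[(Y t ⁻¹' {e}).indicator (fun _ ↦ (1 : ℝ)) |
        MeasurableSpace.comap (past Y t) inferInstance] =ᵐ[P]
          fun ω ↦ (q (past Y t ω)).real {e} := by
  have : Nonempty E := P.nonempty_of_neZero.map (Y t)
  have hpair : Measurable fun ω ↦ (past Y t ω, Y t ω) := (measurable_past hY t).prodMk (hY t)
  have hnext : P.map (past Y (t + 1)) = (P.map fun ω ↦ (past Y t ω, Y t ω)).map pastCons := by
    rw [Measure.map_map pastCons.measurable hpair]
    exact congrArg P.map (funext (past_add_one Y t))
  rw [← map_prodMk_eq_compProd_iff (measurable_past hY t) (hY t), pastKernel_comp_eq_map_compProd,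
    hnext, pastCons.map_measurableEquiv_injective.eq_iff, eq_comm]

lemma IsStationaryChain.invariant_map_past (h : IsStationaryChain q P Y) (t : ℤ) :
    (pastKernel q).Invariant (P.map (past Y t)) :=
  have := h.isProbabilityMeasure
  ((pastKernel_comp_map_past_eq_iff h.measurable t).2 (h.transition t)).trans (h.map_past_eq 1 t)

lemma isStationaryChain_of_map_coordPast {μ : Measure (ℕ → E)} (hμ : (pastKernel q).Invariant μ)
    {ν : Measure (ℤ → E)} [IsProbabilityMeasure ν] (hν : ∀ t, ν.map (coordPast t) = μ) :
    IsStationaryChain q ν fun t ω ↦ ω t where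
  isProbabilityMeasure := inferInstance
  measurable := measurable_pi_apply
  stationary k := by
    have : IsProbabilityMeasure (ν.map fun (ω : ℤ → E) t ↦ ω t) := by
      rw [Measure.map_id']
      infer_instance
    refine measure_ext_of_map_coordPast fun t ↦ ?_
    calc (ν.map fun (ω : ℤ → E) t ↦ ω (t + k)).map (coordPast t)
        = ν.map (past (fun t ω ↦ ω (t + k)) t) :=
          map_coordPast_map (fun t ↦ measurable_pi_apply (t + k)) t
      _ = ν.map (coordPast (t + k)) :=
          congrArg ν.map (past_add_apply (fun t (ω : ℤ → E) ↦ ω t) k t)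
      _ = (ν.map fun (ω : ℤ → E) t ↦ ω t).map (coordPast t) := by rw [Measure.map_id', hν, hν]
  transition t := (pastKernel_comp_map_past_eq_iff measurable_pi_apply t).1 <| by
    rw [hν, hν, hμ.def]

end Countable

variable [Fintype E]

lemma existsUnique_isStationaryChain [Nonempty E] (hb : Tendsto (contCoeff q) atTop (𝓝 0))
    (hu : Tendsto (fun n ↦ houseLaw (contCoeff q) n 0) atTop (𝓝 0)) :
    ∃! ν : Measure (ℤ → E), IsStationaryChain q ν fun t ω ↦ ω t := by
  let _ : TopologicalSpace E := ⊥
  have : DiscreteTopology E := ⟨rfl⟩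
  obtain ⟨μ, _, hμ⟩ := exists_invariant_pastKernel hb
  obtain ⟨ν, _, hν⟩ := exists_map_coordPast_eq (map_tail_of_invariant hμ)
  refine ⟨ν, isStationaryChain_of_map_coordPast hμ hν, fun ν' hν' ↦ ?_⟩
  refine measure_ext_of_map_coordPast fun t ↦ ?_
  have := hν'.isProbabilityMeasure_map_past t
  rw [hν]
  exact invariant_unique hu (hν'.invariant_map_past t) hμ

lemma IsStationaryChain.dTV_map_le {Ω' : Type*} [MeasurableSpace Ω'] {q' : Kernel (ℕ → E) E}
    [IsMarkovKernel q'] {P' : Measure Ω'} {Y' : ℤ → Ω' → E}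
    (hu : Summable fun n ↦ houseLaw (contCoeff q) n 0)
    (h : IsStationaryChain q P Y) (h' : IsStationaryChain q' P' Y') :
    dTV (P.map (Y 0)) (P'.map (Y' 0)) ≤
      (∑' n, houseLaw (contCoeff q) n 0) * ⨆ y, dTV (q y) (q' y) := by
  have := h.isProbabilityMeasure_map_past 1
  have := h'.isProbabilityMeasure_map_past 1
  rw [← h.map_apply_zero, ← h'.map_apply_zero]
  exact dTV_map_apply_zero_le_of_invariant hu (h.invariant_map_past 1) (h'.invariant_map_past 1)

end StationaryChain

section ContinuityCoefficients

variable {E : Type*} [Fintype E] [MeasurableSpace E] {q q' : Kernel (ℕ → E) E}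

lemma contCoeff_eq_zero_of_markov (hq : ∀ y y' : ℕ → E, y 0 = y' 0 → q y = q y') {m : ℕ}
    (hm : 1 ≤ m) : contCoeff q m = 0 :=
  (contCoeff_le q le_rfl fun y y' hy ↦ by rw [hq y y' (hy 0 hm), dTV_self]).antisymm
    (contCoeff_nonneg q m)

lemma summable_contCoeff_of_add
    (h : Summable fun m ↦ contCoeff q (m + 1) + contCoeff q' (m + 1)) :
    Summable (contCoeff q) ∧ Summable (contCoeff q') := by
  constructor <;> refine (summable_nat_add_iff 1).1 (h.of_nonneg_of_le ?_ ?_)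
  · exact fun _ ↦ contCoeff_nonneg q _
  · exact fun _ ↦ le_add_of_nonneg_right (contCoeff_nonneg q' _)
  · exact fun _ ↦ contCoeff_nonneg q' _
  · exact fun _ ↦ le_add_of_nonneg_left (contCoeff_nonneg q _)

variable [DiscreteMeasurableSpace E] [IsMarkovKernel q]

lemma summable_houseLaw_contCoeff (h0 : contCoeff q 0 < 1) (hb : Summable (contCoeff q)) :
    Summable fun n ↦ houseLaw (contCoeff q) n 0 :=
  summable_houseLaw_zero (contCoeff_nonneg q)
    (fun m ↦ (antitone_contCoeff q m.zero_le).trans_lt h0) hb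

lemma existsUnique_isStationaryChain_of_summable [Nonempty E] (h0 : contCoeff q 0 < 1)
    (hb : Summable (contCoeff q)) : ∃! ν : Measure (ℤ → E), IsStationaryChain q ν fun t ω ↦ ω t :=
  existsUnique_isStationaryChain hb.tendsto_atTop_zero
    (summable_houseLaw_contCoeff h0 hb).tendsto_atTop_zero

end ContinuityCoefficients

end CompleteConnections

end

open CompleteConnections in
theorem corollary1_general {E : Type*} [Fintype E] [Nonempty E] [MeasurableSpace E]
    [DiscreteMeasurableSpace E] (q qbar : Kernel (ℕ → E) E) [IsMarkovKernel q]
    [IsMarkovKernel qbar] (hq : contCoeff q 0 < 1) (hsum : Summable (contCoeff q)) :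
    (∃! ν : Measure (ℤ → E), IsStationaryChain q ν fun t ω ↦ ω t) ∧
    Summable (bStar (contCoeff q)) ∧
    (∀ {Ω Ωbar : Type*} [MeasurableSpace Ω] [MeasurableSpace Ωbar]
      (P : Measure Ω) (Pbar : Measure Ωbar) (Y : ℤ → Ω → E) (Ybar : ℤ → Ωbar → E),
      IsStationaryChain q P Y → IsStationaryChain qbar Pbar Ybar →
      dTV (P.map (Y 0)) (Pbar.map (Ybar 0)) ≤
        (1 + ∑' m, bStar (contCoeff q) m) * ⨆ y, dTV (q y) (qbar y)) ∧
    ((∀ y y' : ℕ → E, y 0 = y' 0 → q y = q y') →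
      (∀ m, 1 ≤ m → contCoeff q m = 0) ∧
      (∀ m, 1 ≤ m → bStar (contCoeff q) m = contCoeff q 0 ^ m) ∧
      1 + ∑' m, bStar (contCoeff q) (m + 1) = (1 - contCoeff q 0)⁻¹ ∧
      (∀ {Ω Ωbar : Type*} [MeasurableSpace Ω] [MeasurableSpace Ωbar]
        (P : Measure Ω) (Pbar : Measure Ωbar) (Y : ℤ → Ω → E) (Ybar : ℤ → Ωbar → E),
        IsStationaryChain q P Y → IsStationaryChain qbar Pbar Ybar →
        dTV (P.map (Y 0)) (Pbar.map (Ybar 0)) ≤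
          (1 - contCoeff q 0)⁻¹ * ⨆ y, dTV (q y) (qbar y))) := by
  have hu := summable_houseLaw_contCoeff hq hsum
  refine ⟨existsUnique_isStationaryChain_of_summable hq hsum, summable_bStar hu,
    fun P Pbar Y Ybar h hbar ↦ ?_, fun hmarkov ↦ ?_⟩
  · refine (h.dTV_map_le hu hbar).trans (mul_le_mul_of_nonneg_right ?_ ?_)
    · exact tsum_houseLaw_zero_le (contCoeff_nonneg q 0) hu
    · exact Real.iSup_nonneg fun y ↦ dTV_nonneg _ _
  · have hb : ∀ m, 1 ≤ m → contCoeff q m = 0 := fun m ↦ contCoeff_eq_zero_of_markov hmarkov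
    have htsum := tsum_houseLaw_zero_of_eq_zero hb (contCoeff_nonneg q 0) hq
    refine ⟨hb, fun m hm ↦ ?_, (tsum_houseLaw_zero hu).symm.trans htsum,
      fun P Pbar Y Ybar h hbar ↦ ?_⟩
    · rw [bStar, if_neg (by lia), houseLaw_zero_of_eq_zero hb]
    · rw [← htsum]
      exact h.dTV_map_le hu hbar

theorem corollary1 {E : Type*} [Fintype E] [Nonempty E] [MeasurableSpace E]
    [DiscreteMeasurableSpace E]
    (q qbar : ProbabilityTheory.Kernel (ℕ → E) E)
    [ProbabilityTheory.IsMarkovKernel q] [ProbabilityTheory.IsMarkovKernel qbar]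
    (hq₁ : CompleteConnections.PositiveKernel q)
    (hq₂ : CompleteConnections.ContinuousKernel q)
    (hqbar₁ : CompleteConnections.PositiveKernel qbar)
    (hqbar₂ : CompleteConnections.ContinuousKernel qbar)
    (hsum : Summable fun m : ℕ =>
      CompleteConnections.contCoeff q (m + 1) + CompleteConnections.contCoeff qbar (m + 1)) :
    -- the stationary chains exist and are unique in law
    (∃! ν : MeasureTheory.Measure (ℤ → E),
      CompleteConnections.IsStationaryChain q ν (fun t ω => ω t)) ∧
    (∃! ν : MeasureTheory.Measure (ℤ → E),
      CompleteConnections.IsStationaryChain qbar ν (fun t ω => ω t)) ∧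
    -- the perturbation bound, with a finite constant
    Summable (CompleteConnections.bStar (CompleteConnections.contCoeff q)) ∧
    (∀ {Ω Ωbar : Type*} [MeasurableSpace Ω] [MeasurableSpace Ωbar]
      (P : MeasureTheory.Measure Ω) (Pbar : MeasureTheory.Measure Ωbar)
      (Y : ℤ → Ω → E) (Ybar : ℤ → Ωbar → E),
      CompleteConnections.IsStationaryChain q P Y →
      CompleteConnections.IsStationaryChain qbar Pbar Ybar →
      CompleteConnections.dTV (P.map (Y 0)) (Pbar.map (Ybar 0)) ≤
        (1 + ∑' m : ℕ, CompleteConnections.bStar (CompleteConnections.contCoeff q) m) *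
          ⨆ y : ℕ → E, CompleteConnections.dTV (q y) (qbar y)) ∧
    -- the Markov case: `q` depends on the most recent coordinate only
    ((∀ y y' : ℕ → E, y 0 = y' 0 → q y = q y') →
      (∀ m : ℕ, 1 ≤ m → CompleteConnections.contCoeff q m = 0) ∧
      (∀ m : ℕ, 1 ≤ m → CompleteConnections.bStar (CompleteConnections.contCoeff q) m =
        CompleteConnections.contCoeff q 0 ^ m) ∧
      1 + ∑' m : ℕ, CompleteConnections.bStar (CompleteConnections.contCoeff q) (m + 1) =
        (1 - CompleteConnections.contCoeff q 0)⁻¹ ∧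
      (∀ {Ω Ωbar : Type*} [MeasurableSpace Ω] [MeasurableSpace Ωbar]
        (P : MeasureTheory.Measure Ω) (Pbar : MeasureTheory.Measure Ωbar)
        (Y : ℤ → Ω → E) (Ybar : ℤ → Ωbar → E),
        CompleteConnections.IsStationaryChain q P Y →
        CompleteConnections.IsStationaryChain qbar Pbar Ybar →
        CompleteConnections.dTV (P.map (Y 0)) (Pbar.map (Ybar 0)) ≤
          (1 - CompleteConnections.contCoeff q 0)⁻¹ *
            ⨆ y : ℕ → E, CompleteConnections.dTV (q y) (qbar y))) :=
  have ⟨hb, hbbar⟩ := CompleteConnections.summable_contCoeff_of_add hsum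
  have ⟨hν, h⟩ := corollary1_general q qbar hq₂.1 hb
  ⟨hν, CompleteConnections.existsUnique_isStationaryChain_of_summable hqbar₂.1 hbbar, h⟩
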